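/- Let $\mathbb{K}$ be an algebraically closed field of characteristic $p>0$ and let $G$ be an affine algebraic group over $\mathbb{K}$, given by a finitely generated commutative Hopf algebra $\mathbb{K}[G]$ (for example $G$ connected, simply connected reductive with $p$ good for $G$). Let $\mathfrak{g}$ be its Lie algebra of left invariant derivations of $\mathbb{K}[G]$, with $x\mapsto x^{[p]}$ the $p$-th power of derivations, and assume that $\mathfrak{g}$ carries a non-degenerate $G(\mathbb{K})$-invariant bilinear form $(\cdot,\cdot)$. Let $e\in\mathfrak{g}$ be nilpotent (that is, $e^{[p]^i}=0$ for some $i$), and put $\chi=(e,\cdot)\in\mathfrak{g}^*$. Let $\lambda:\mathbb{K}^\times\to G$ be a cocharacter with weight spaces $\mathfrak{g}(i)=\{x : \operatorname{Ad}(\lambda(t))x=t^ix \text{ for all } t\}$ such that $e\in\mathfrak{g}(2)$ and the centraliser $\mathfrak{g}_e$ lies in $\bigoplus_{i\ge 0}\mathfrak{g}(i)$. Let $\mathfrak{l}\subseteq\mathfrak{g}(-1)$ be a maximal totally isotropic subspace for the form $(x,y)\mapsto(e,[x,y])$, where, if $p=2$, we also require $(e,u^{[2]})=0$ for all $u\in\mathfrak{l}$.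 Put $\mathfrak{m}=\mathfrak{l}\oplus\bigoplus_{i<-1}\mathfrak{g}(i)$. Let $Z_0(\mathfrak{g})\subseteq U(\mathfrak{g})$ be the $p$-centre, the subalgebra generated by the elements $\xi(x)=x^p-x^{[p]}$, $x\in\mathfrak{g}$. For $\eta\in\mathfrak{g}^*$ let $I_\eta$ be the ideal of $Z_0(\mathfrak{g})$ generated by the $\xi(x)-\eta(x)^p$, $x\in\mathfrak{g}$. Let $\mathfrak{m}^\perp=\{\psi\in\mathfrak{g}^*:\psi(\mathfrak{m})=0\}$ and $I(\mathfrak{m})=\bigcap_{\eta\in\chi+\mathfrak{m}^\perp}I_\eta$, i.e. the ideal of elements of $Z_0(\mathfrak{g})$ which, as regular functions on $\mathfrak{g}^*$, vanish on $\chi+\mathfrak{m}^\perp$. Let $\mathscr{W}_p(\mathfrak{g},\chi)$ be the full subcategory of $U(\mathfrak{g})$-mod of the modules killed by $I(\mathfrak{m})$ ($p$-Whittaker modules), and $\mathscr{W}(\mathfrak{g},\chi)$ the full subcategory of the modules on which $x-\chi(x)$ acts locally nilpotently for every $x\in\mathfrak{m}$ (generalised Whittaker modules). Then $\mathscr{W}_p(\mathfrak{g},\chi)$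 is a full subcategory of $\mathscr{W}(\mathfrak{g},\chi)$. Moreover, for every $x\in\mathfrak{m}$: (1) $(x-\chi(x))^{p^i}\equiv x^{[p]^i} \pmod{I(\mathfrak{m})U(\mathfrak{g})}$ for all $i>0$; (2) there is $i>0$ with $x^{[p]^i}=0$ and $(x-\chi(x))^{p^i}\in I(\mathfrak{m})U(\mathfrak{g})$; (3) there is $N\in\mathbb{N}$, depending on $x$ but not on the module, such that $(x-\chi(x))^N$ acts as zero on every module in $\mathscr{W}_p(\mathfrak{g},\chi)$. -/

import Mathlib

open scoped TensorProduct LaurentPolynomial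

universe u v w

noncomputable section

namespace ModularW

section Derivations

variable {K : Type u} [CommRing K] {A : Type v} [CommRing A] [Algebra K A]

/-- In characteristic `p`, the `p`-th iterate of a derivation is a derivation. -/
theorem pow_char_leibniz (p : ℕ) [Fact p.Prime] [CharP K p] (D : Derivation K A A) (a b : A) :
    ((D : A →ₗ[K] A) ^ p) (a * b) =
      a * ((D : A →ₗ[K] A) ^ p) b + b * ((D : A →ₗ[K] A) ^ p) a := by
  have hleib : ∀ n : ℕ, ∀ a b : A, ((D : A →ₗ[K] A) ^ n) (a * b) =
      ∑ ij ∈ Finset.HasAntidiagonal.antidiagonal n,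
        (n.choose ij.1) • (((D : A →ₗ[K] A) ^ ij.1) a * ((D : A →ₗ[K] A) ^ ij.2) b) := by
    intro n
    induction n with
    | zero => intro a b; simp
    | succ n ih =>
      intro a b
      rw [Finset.sum_antidiagonal_choose_succ_nsmul
        (fun i j => ((D : A →ₗ[K] A) ^ i) a * ((D : A →ₗ[K] A) ^ j) b), pow_succ',
        Module.End.mul_apply, ih, map_sum, ← Finset.sum_add_distrib]
      refine Finset.sum_congr rfl fun ij hij => ?_
      rw [map_nsmul, pow_succ', pow_succ', Module.End.mul_apply, Module.End.mul_apply]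
      have hs : n.choose ij.2 = n.choose ij.1 := by
        rw [Finset.HasAntidiagonal.mem_antidiagonal] at hij
        exact Nat.choose_symm_of_eq_add (by omega)
      rw [hs, ← nsmul_add]
      congr 1
      simp only [Derivation.coeFn_coe, Derivation.leibniz, smul_eq_mul]
      ring
  have hp : p.Prime := Fact.out
  rw [hleib, Finset.sum_eq_add (0, p) (p, 0) (by simp [hp.ne_zero.symm])]
  · simp
    ring
  · rintro ⟨i, j⟩ hij hne
    rw [Finset.HasAntidiagonal.mem_antidiagonal] at hij
    simp only at hij
    have hi0 : i ≠ 0 := by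
      rintro rfl; apply hne.1; simp at hij; simp [hij]
    have hip : i < p := by
      rcases Nat.lt_or_ge i p with h | h
      · exact h
      · exact absurd (by ext <;> simp <;> omega) hne.2
    obtain ⟨c, hc⟩ := hp.dvd_choose_self hi0 hip
    have h0 : ((p : ℕ) : K) = 0 := CharP.cast_eq_zero K p
    rw [← Nat.cast_smul_eq_nsmul K, hc, Nat.cast_mul, h0]
    simp
  · simp
  · simp

/-- The derivation `D ^ p` (the `p`-fold composite of `D` with itself) in characteristic `p`. -/
def derivationPow (p : ℕ) [Fact p.Prime] [CharP K p] (D : Derivation K A A) :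
    Derivation K A A :=
  Derivation.mk' ((D : A →ₗ[K] A) ^ p) fun a b => by
    simpa using pow_char_leibniz p D a b

theorem derivationPow_apply (p : ℕ) [Fact p.Prime] [CharP K p] (D : Derivation K A A) (a : A) :
    derivationPow p D a = ((D : A →ₗ[K] A) ^ p) a := rfl

end Derivations

section Group

/-! An affine algebraic group `G` over `K` is given by its coordinate ring `A = K[G]`, a finitely
generated commutative Hopf algebra over `K`. -/

variable (K : Type u) [Field K] (A : Type v) [CommRing A] [HopfAlgebra K A]

/-- The group `G(K)` of `K`-points, with multiplication `(g h)(f) = ∑ g(f₁) h(f₂)`. -/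
abbrev Points : Type (max u v) := WithConv (A →ₐ[K] K)

/-- The Lie algebra of `G`: the left invariant derivations of `K[G]`, that is, those `D` with
`Δ ∘ D = (id ⊗ D) ∘ Δ`, under the commutator bracket. -/
def lieAlg : LieSubalgebra K (Derivation K A A) where
  carrier := {D | ∀ a, Coalgebra.comul (R := K) (D a) =
    LinearMap.lTensor A (D : A →ₗ[K] A) (Coalgebra.comul (R := K) a)}
  zero_mem' := by intro a; simp
  add_mem' := by
    intro D E hD hE a
    simp only [Set.mem_ofPred_eq] at hD hE ⊢
    simp [hD, hE, LinearMap.lTensor_add]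
  smul_mem' := by
    intro c D hD a
    simp only [Set.mem_ofPred_eq] at hD ⊢
    simp [hD, LinearMap.lTensor_smul]
  lie_mem' := by
    intro D E hD hE a
    simp only [Set.mem_ofPred_eq] at hD hE ⊢
    have : ((⁅D, E⁆ : Derivation K A A) : A →ₗ[K] A) =
        (D : A →ₗ[K] A) ∘ₗ (E : A →ₗ[K] A) - (E : A →ₗ[K] A) ∘ₗ (D : A →ₗ[K] A) := by
      ext x; rfl
    rw [this, LinearMap.lTensor_sub, LinearMap.lTensor_comp, LinearMap.lTensor_comp,
      Derivation.commutator_apply]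
    simp [hD, hE]

variable {K A}

theorem comul_pow_apply {D : Derivation K A A} (hD : D ∈ lieAlg K A) (n : ℕ) (a : A) :
    Coalgebra.comul (R := K) (((D : A →ₗ[K] A) ^ n) a) =
      LinearMap.lTensor A ((D : A →ₗ[K] A) ^ n) (Coalgebra.comul (R := K) a) := by
  induction n with
  | zero => simp [Module.End.one_eq_id]
  | succ n ih =>
    rw [pow_succ', Module.End.mul_eq_comp, LinearMap.lTensor_comp, LinearMap.comp_apply,
      LinearMap.comp_apply, ← ih]
    exact hD _

/-- The `p`-operation `x ↦ x^[p]` on `Lie G`: the `p`-th power as a derivation of `K[G]`. -/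
def pMap (p : ℕ) [Fact p.Prime] [CharP K p] (x : lieAlg K A) : lieAlg K A :=
  ⟨derivationPow p x.1, fun a => by
    have h : ((derivationPow p x.1 : Derivation K A A) : A →ₗ[K] A) =
      (x.1 : A →ₗ[K] A) ^ p := rfl
    rw [h]
    exact comul_pow_apply x.2 p a⟩

/-- Right translation of functions, `(ρ_g f)(h) = f(h g)`. -/
def rightTranslation (g : Points K A) : A →ₐ[K] A :=
  (Algebra.TensorProduct.rid K K A).toAlgHom.comp
    ((Algebra.TensorProduct.map (AlgHom.id K A) g.ofConv).comp (Bialgebra.comulAlgHom K A))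

theorem rightTranslation_toLinearMap (g : Points K A) :
    (rightTranslation g).toLinearMap = (TensorProduct.rid K A).toLinearMap ∘ₗ
      LinearMap.lTensor A g.ofConv.toLinearMap ∘ₗ Coalgebra.comul := rfl

theorem comul_rightTranslation (g : Points K A) (a : A) :
    Coalgebra.comul (R := K) (rightTranslation g a) =
      LinearMap.lTensor A (rightTranslation g).toLinearMap (Coalgebra.comul (R := K) a) := by
  have h := Coalgebra.coassoc_apply (R := K) a
  rw [rightTranslation_toLinearMap, LinearMap.lTensor_comp, LinearMap.lTensor_comp,
    LinearMap.comp_apply, LinearMap.comp_apply, ← h]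
  have : ∀ z : A ⊗[K] A, Coalgebra.comul (R := K)
      (TensorProduct.rid K A (LinearMap.lTensor A g.ofConv.toLinearMap z)) =
      LinearMap.lTensor A (TensorProduct.rid K A).toLinearMap
        (LinearMap.lTensor A (LinearMap.lTensor A g.ofConv.toLinearMap)
          (TensorProduct.assoc K A A A (LinearMap.rTensor A Coalgebra.comul z))) := by
    intro z
    induction z with
    | zero => simp
    | add x y hx hy => simp only [map_add, hx, hy]
    | tmul x y =>
      simp only [LinearMap.lTensor_tmul, TensorProduct.rid_tmul, LinearMap.rTensor_tmul, map_smul]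
      generalize (Coalgebra.comul (R := K) x) = c
      induction c with
      | zero => simp
      | add c d hc hd => simp only [map_add, hc, hd, TensorProduct.add_tmul, smul_add]
      | tmul c d => simp
  exact this _

theorem rightTranslation_one : rightTranslation (1 : Points K A) = AlgHom.id K A := by
  ext a
  have h := Coalgebra.lTensor_counit_comul (R := K) a
  have h2 : rightTranslation (1 : Points K A) a =
    TensorProduct.rid K A (LinearMap.lTensor A (Coalgebra.counit (R := K))
      (Coalgebra.comul (R := K) a)) := rfl
  rw [h2, h]
  simp

theorem rightTranslation_mul (g h : Points K A) :
    rightTranslation (g * h) = (rightTranslation g).comp (rightTranslation h) := by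
  ext a
  have e1 : ∀ x, rightTranslation h x = TensorProduct.rid K A
    (LinearMap.lTensor A h.ofConv.toLinearMap (Coalgebra.comul (R := K) x)) := fun _ => rfl
  have e2 : rightTranslation (g * h) a = TensorProduct.rid K A
    (LinearMap.lTensor A (g * h).ofConv.toLinearMap (Coalgebra.comul (R := K) a)) := rfl
  rw [AlgHom.comp_apply, e2, e1]
  have h1 := Coalgebra.coassoc_apply (R := K) a
  have key1 : ∀ z : A ⊗[K] A,
      rightTranslation g (TensorProduct.rid K A (LinearMap.lTensor A h.ofConv.toLinearMap z)) =
      TensorProduct.rid K A (LinearMap.lTensor A (LinearMap.mul' K K)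
        (LinearMap.lTensor A (TensorProduct.map g.ofConv.toLinearMap h.ofConv.toLinearMap)
          (TensorProduct.assoc K A A A (LinearMap.rTensor A Coalgebra.comul z)))) := by
    intro z
    induction z with
    | zero => simp
    | add x y hx hy => simp only [map_add, hx, hy]
    | tmul x y =>
      have e3 : rightTranslation g x = TensorProduct.rid K A
        (LinearMap.lTensor A g.ofConv.toLinearMap (Coalgebra.comul (R := K) x)) := rfl
      simp only [LinearMap.lTensor_tmul, TensorProduct.rid_tmul, LinearMap.rTensor_tmul, map_smul,
        e3]
      generalize (Coalgebra.comul (R := K) x) = c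
      induction c with
      | zero => simp
      | add c d hc hd => simp only [map_add, hc, hd, TensorProduct.add_tmul, smul_add]
      | tmul c d => simp [smul_smul, mul_comm]
  rw [key1, h1]
  have key2 : (g * h).ofConv.toLinearMap = LinearMap.mul' K K ∘ₗ
      TensorProduct.map g.ofConv.toLinearMap h.ofConv.toLinearMap ∘ₗ Coalgebra.comul := by
    ext x
    rfl
  rw [key2, LinearMap.lTensor_comp, LinearMap.lTensor_comp]
  rfl

theorem rightTranslation_inv_apply (g : Points K A) (a : A) :
    rightTranslation g (rightTranslation g⁻¹ a) = a := by
  rw [← AlgHom.comp_apply, ← rightTranslation_mul, mul_inv_cancel, rightTranslation_one]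
  rfl

/-- The adjoint action of `g ∈ G(K)` on `Lie G`: `Ad(g) D = ρ_g ∘ D ∘ ρ_g⁻¹`. -/
def Ad (g : Points K A) : lieAlg K A →ₗ[K] lieAlg K A where
  toFun x := ⟨Derivation.mk' ((rightTranslation g).toLinearMap ∘ₗ (x.1 : A →ₗ[K] A) ∘ₗ
      (rightTranslation g⁻¹).toLinearMap) fun a b => by
        simp [rightTranslation_inv_apply], fun a => by
      have h1 : ∀ b, Coalgebra.comul (R := K) (x.1 b) =
        LinearMap.lTensor A (x.1 : A →ₗ[K] A) (Coalgebra.comul (R := K) b) := x.2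
      have h2 : ((Derivation.mk' ((rightTranslation g).toLinearMap ∘ₗ (x.1 : A →ₗ[K] A) ∘ₗ
        (rightTranslation g⁻¹).toLinearMap) fun a b => by
          simp [rightTranslation_inv_apply] : Derivation K A A) : A →ₗ[K] A) =
        (rightTranslation g).toLinearMap ∘ₗ (x.1 : A →ₗ[K] A) ∘ₗ
          (rightTranslation g⁻¹).toLinearMap := rfl
      rw [h2, LinearMap.lTensor_comp, LinearMap.lTensor_comp, LinearMap.comp_apply,
        LinearMap.comp_apply, ← comul_rightTranslation, ← h1, ← comul_rightTranslation]
      rfl⟩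
  map_add' x y := by
    ext a
    exact map_add (rightTranslation g) _ _
  map_smul' c x := by
    ext a
    exact map_smul (rightTranslation g) c _

theorem Ad_apply (g : Points K A) (x : lieAlg K A) (a : A) :
    (Ad g x).1 a = rightTranslation g (x.1 (rightTranslation g⁻¹ a)) := rfl

/-- The value `lam(t) ∈ G(K)` at `t ∈ Kˣ` of a cocharacter `lam : 𝔾ₘ → G`; the latter is a
morphism of algebraic groups, given by its comorphism `K[G] → K[T, T⁻¹]`. -/
def cocharAt (lam : A →ₐc[K] K[T;T⁻¹]) (t : Kˣ) : Points K A :=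
  WithConv.toConv
    (({ LaurentPolynomial.eval₂ (RingHom.id K) t with
        commutes' := fun r => by
          simp [LaurentPolynomial.algebraMap_apply] } : K[T;T⁻¹] →ₐ[K] K).comp
      (lam : A →ₐ[K] K[T;T⁻¹]))

/-- The weight space `𝔤(i) = {x | Ad(lam(t)) x = t ^ i x for all t}`. -/
def weightSpace (lam : A →ₐc[K] K[T;T⁻¹]) (i : ℤ) : Submodule K (lieAlg K A) where
  carrier := {x | ∀ t : Kˣ, Ad (cocharAt lam t) x = ((t ^ i : Kˣ) : K) • x}
  zero_mem' := by intro t; simp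
  add_mem' := by
    intro x y hx hy t
    rw [map_add, hx t, hy t, smul_add]
  smul_mem' := by
    intro c x hx t
    rw [map_smul, hx t, smul_comm]

/-- A bilinear form on `Lie G` is `G`-invariant. -/
def IsInvariantForm (B : LinearMap.BilinForm K (lieAlg K A)) : Prop :=
  ∀ (g : Points K A) (x y : lieAlg K A), B (Ad g x) (Ad g y) = B x y

/-- `e` is nilpotent: some iterated `p`-th power `e^{[p]^i}` vanishes. -/
def IsPNilpotent (p : ℕ) [Fact p.Prime] [CharP K p] (e : lieAlg K A) : Prop :=
  ∃ i : ℕ, (pMap p)^[i] e = 0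

/-- `lam` is a Dynkin torus for `e`: `e ∈ 𝔤(2)` and the centraliser of `e` is contained in
the sum of the `𝔤(i)` with `i ≥ 0`. -/
structure IsDynkinTorus (lam : A →ₐc[K] K[T;T⁻¹]) (e : lieAlg K A) : Prop where
  mem_two : e ∈ weightSpace lam 2
  centraliser_le : ∀ x : lieAlg K A, ⁅e, x⁆ = 0 → x ∈ ⨆ i ≥ (0 : ℤ), weightSpace lam i

/-- `l` is a maximal totally isotropic subspace of `𝔤(-1)` for `Φ(x, y) = (e, [x, y])`; if
`p = 2` then moreover `(e, u^[2]) = 0` for all `u ∈ l`. -/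
structure IsLagrangian (p : ℕ) [Fact p.Prime] [CharP K p]
    (B : LinearMap.BilinForm K (lieAlg K A)) (e : lieAlg K A) (lam : A →ₐc[K] K[T;T⁻¹])
    (l : Submodule K (lieAlg K A)) : Prop where
  maximal : Maximal (fun l' : Submodule K (lieAlg K A) =>
    l' ≤ weightSpace lam (-1) ∧ ∀ x ∈ l', ∀ y ∈ l', B e ⁅x, y⁆ = 0) l
  two : p = 2 → ∀ u ∈ l, B e (pMap p u) = 0

/-- `𝔪 = l ⊕ ∑_{i < -1} 𝔤(i)`. -/
def premetM (lam : A →ₐc[K] K[T;T⁻¹]) (l : Submodule K (lieAlg K A)) :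
    Submodule K (lieAlg K A) :=
  l ⊔ ⨆ i < (-1 : ℤ), weightSpace lam i

variable (K A) in
/-- The enveloping algebra `U(𝔤)` of `𝔤 = Lie G`. -/
abbrev Ug : Type (max u v) := UniversalEnvelopingAlgebra K (lieAlg K A)

/-- The natural map `𝔤 → U(𝔤)`. -/
abbrev incl (x : lieAlg K A) : Ug K A := UniversalEnvelopingAlgebra.ι K x

/-- `ξ(x) = x^p - x^[p]` in `U(𝔤)`. -/
def xi (p : ℕ) [Fact p.Prime] [CharP K p] (x : lieAlg K A) : Ug K A :=
  incl x ^ p - incl (pMap p x)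

variable (K A) in
/-- The `p`-centre `Z₀(𝔤)`, the subalgebra of `U(𝔤)` generated by all `ξ(x)`. -/
def pCentre (p : ℕ) [Fact p.Prime] [CharP K p] : Subalgebra K (Ug K A) :=
  Algebra.adjoin K (Set.range (xi p))

/-- The ideal `I_η` of `Z₀(𝔤)` generated by all `ξ(x) - η(x)^p`; it is the maximal ideal
corresponding to the point `η` of `𝔤*`. -/
def pointIdeal (p : ℕ) [Fact p.Prime] [CharP K p] (η : Module.Dual K (lieAlg K A)) :
    Ideal (pCentre K A p) :=
  Ideal.span (Set.range fun x : lieAlg K A =>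
    (⟨xi p x, Algebra.subset_adjoin ⟨x, rfl⟩⟩ : pCentre K A p) -
      algebraMap K (pCentre K A p) (η x ^ p))

/-- The ideal `I(𝔪)` of `Z₀(𝔤)`: the functions on `𝔤*` vanishing on `χ + 𝔪^⊥`, that is, the
elements of `Z₀(𝔤)` lying in `I_η` for every `η ∈ χ + 𝔪^⊥`. -/
def idealM (p : ℕ) [Fact p.Prime] [CharP K p] (χ : Module.Dual K (lieAlg K A))
    (m : Submodule K (lieAlg K A)) : Ideal (pCentre K A p) :=
  ⨅ ψ ∈ m.dualAnnihilator, pointIdeal p (χ + ψ)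

/-- For an ideal `I` of `Z₀(𝔤)`, the ideal `I U(𝔤)` of `U(𝔤)`: the sums of products `z u`. -/
def extIdeal (p : ℕ) [Fact p.Prime] [CharP K p] (I : Ideal (pCentre K A p)) :
    Submodule K (Ug K A) :=
  Submodule.span K {w | ∃ z ∈ I, ∃ u : Ug K A, w = (z : Ug K A) * u}

/-- `x - χ(x)` in `U(𝔤)`. -/
def shift (χ : Module.Dual K (lieAlg K A)) (x : lieAlg K A) : Ug K A :=
  incl x - algebraMap K (Ug K A) (χ x)

/-- The `p`-Whittaker modules: the `U(𝔤)`-modules on which `I(𝔪)` acts by zero. The category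
`𝒲_p(𝔤, χ)` is the full subcategory on these objects. -/
def pWhittaker (p : ℕ) [Fact p.Prime] [CharP K p] (χ : Module.Dual K (lieAlg K A))
    (m : Submodule K (lieAlg K A)) :
    CategoryTheory.ObjectProperty (ModuleCat.{w} (Ug K A)) :=
  fun V => ∀ z ∈ idealM p χ m, ∀ v : V, (z : Ug K A) • v = 0

/-- The generalised Whittaker modules: the `U(𝔤)`-modules on which `x - χ(x)` acts locally
nilpotently for all `x ∈ 𝔪`. The category `𝒲(𝔤, χ)` is the full subcategory on these objects. -/
def genWhittaker (χ : Module.Dual K (lieAlg K A)) (m : Submodule K (lieAlg K A)) :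
    CategoryTheory.ObjectProperty (ModuleCat.{w} (Ug K A)) :=
  fun V => ∀ x ∈ m, ∀ v : V, ∃ n : ℕ, shift χ x ^ n • v = 0

end Group

end ModularW

end

namespace ModularW

/-! ### Noncommutative algebra in characteristic `p`: Jacobson's formula. -/

section CharP

open Polynomial

/-! For `x ∈ 𝔪`, every functional in `χ + 𝔪^⊥` takes the value `χ(x)` at `x`, so `ξ(x) - χ(x)^p`
lies in `I(𝔪)`. By Frobenius this says `(x - χ(x))^p ≡ x^[p]` (`shift_pow_sub_mem`). The congruence
iterates (`shift_pow_pow_sub_mem`) because `𝔪` is closed under the `p`-operation and `χ` vanishes on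
`p`-th powers from `𝔪`, so that no shift is needed after the first stage.

Both facts are weight arguments: `𝔪` lies in weights at most `-1` and contains all weights at most
`-2`. The `p`-operation multiplies an upper bound on weights by `p`; it is not additive, but
Jacobson's formula (`add_pow_sub_mem`) puts the error among `p`-fold commutators, which obey the
same bound. By invariance `e`, of weight `2`, is orthogonal to all weights at most `-3`. This
settles odd `p`; for `p = 2` the only contribution in weight `-2` that matters is `u^[2]` with `u ∈
l`, which the extra condition on `l` handles (`form_pMap_eq_zero`).

As `K[G]` is finitely generated, `𝔤` is finite-dimensional and has finitely many weights. Iterated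
`p`-th powers of `x` fall below all of them and vanish, so a power of `x - χ(x)` depending only on
`x` lies in `I(𝔪) U(𝔤)`, which kills every `p`-Whittaker module. -/

theorem choose_prime_sub_one_cast {R : Type*} [Ring R] {p : ℕ} [hp : Fact p.Prime]
    (h : (p : R) = 0) (k : ℕ) (hk : k < p) : ((p - 1).choose k : R) = (-1) ^ k := by
  induction k with
  | zero => simp
  | succ k ih =>
    obtain ⟨c, hc⟩ := hp.out.dvd_choose_self k.succ_ne_zero hk
    -- Pascal's rule: the left side vanishes modulo `p`, so consecutive coefficients in row `p - 1`
    -- are negatives of each other.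
    have h1 : p.choose (k + 1) = (p - 1).choose k + (p - 1).choose (k + 1) := by
      conv_lhs => rw [← Nat.sub_add_cancel hp.out.one_le]
      exact Nat.choose_succ_succ _ _
    have h2 : (((p - 1).choose k + (p - 1).choose (k + 1) : ℕ) : R) = 0 := by
      rw [← h1, hc, Nat.cast_mul, h, zero_mul]
    rw [Nat.cast_add, ih (by omega)] at h2
    rw [pow_succ, mul_neg_one]
    exact (neg_eq_of_add_eq_zero_right h2).symm

/-- In the binomial expansion of `(a - b) ^ (p - 1)` the coefficients are `±1` modulo `p`, and their
signs cancel those of the powers of `-b`. -/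
theorem geom_sum_eq_sub_pow {R : Type*} [Ring R] {p : ℕ} [hp : Fact p.Prime]
    (h : (p : R) = 0) {a b : R} (hab : Commute a b) :
    ∑ i ∈ Finset.range p, a ^ i * b ^ (p - 1 - i) = (a - b) ^ (p - 1) := by
  rw [sub_eq_add_neg, hab.neg_right.add_pow, Nat.sub_add_cancel hp.out.one_le]
  refine Finset.sum_congr rfl fun i hi => ?_
  have hi' := Finset.mem_range.1 hi
  rw [← Nat.choose_symm (by omega : i ≤ p - 1),
    choose_prime_sub_one_cast h _ (by omega : p - 1 - i < p), neg_pow b, mul_assoc, mul_assoc,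
    ((Commute.neg_one_left b).pow_pow _ _).symm.eq, ← mul_assoc ((-1 : R) ^ _), ← pow_add,
    Even.neg_one_pow ⟨_, rfl⟩, one_mul]

variable {K : Type*} [Field K] {R : Type*} [Ring R] [Algebra K R]

theorem natCast_eq_zero_of_algebra (p : ℕ) [CharP K p] : (p : R) = 0 := by
  rw [← map_natCast (algebraMap K R), CharP.cast_eq_zero, map_zero]

/-- Over a noncommutative `R` a polynomial need not commute with its derivative, so the Leibniz rule
has to keep the order of the factors. -/
theorem derivative_pow_eq_sum (f : R[X]) (n : ℕ) :
    derivative (f ^ n) = ∑ i ∈ Finset.range n, f ^ i * derivative f * f ^ (n - 1 - i) := by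
  induction n with
  | zero => simp
  | succ n ih =>
    rw [pow_succ, derivative_mul, ih, Finset.sum_range_succ, Finset.sum_mul]
    congr 1
    · refine Finset.sum_congr rfl fun i hi => ?_
      have hi' := Finset.mem_range.1 hi
      rw [mul_assoc _ _ f, ← pow_succ]
      congr 2
      omega
    · simp

variable (K) in
/-- The commutator map `g ↦ f g - g f`. -/
def adEnd (f : R) : Module.End K R := LinearMap.mulLeft K f - LinearMap.mulRight K f

theorem adEnd_apply (f g : R) : adEnd K f g = f * g - g * f := rfl

/-- Left and right multiplication by `f` commute, so the geometric sum identity applies to them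
inside `Module.End K R`. -/
theorem adEnd_pow_sub_one (p : ℕ) [Fact p.Prime] [CharP K p] (f g : R) :
    (adEnd K f ^ (p - 1)) g = ∑ i ∈ Finset.range p, f ^ i * g * f ^ (p - 1 - i) := by
  have h : ((p : ℕ) : Module.End K R) = 0 := natCast_eq_zero_of_algebra (K := K) p
  rw [adEnd, ← geom_sum_eq_sub_pow h (LinearMap.commute_mulLeft_right f f), LinearMap.sum_apply]
  refine Finset.sum_congr rfl fun i _ => ?_
  rw [Module.End.mul_apply, LinearMap.pow_mulLeft, LinearMap.pow_mulRight,
    LinearMap.mulLeft_apply, LinearMap.mulRight_apply, mul_assoc]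

/-- In characteristic `p`, the derivative of `f ^ p` is `(ad f) ^ (p - 1)` applied to `f'`. -/
theorem derivative_pow_prime (p : ℕ) [Fact p.Prime] [CharP K p] (f : R[X]) :
    derivative (f ^ p) =
      (adEnd K f ^ (p - 1)) (derivative f) := by
  rw [derivative_pow_eq_sum, adEnd_pow_sub_one]

/-- `T k` is any receptacle for `k`-fold commutators of `x` and `y` starting from `x`. Since `X` is
central, bracketing with `C x * X + C y` acts on coefficients by brackets with `x` and with `y`. -/
theorem coeff_ad_pow_mem (T : ℕ → Submodule K R) {x y : R} (hx0 : x ∈ T 0)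
    (hx : ∀ k, ∀ z ∈ T k, x * z - z * x ∈ T (k + 1))
    (hy : ∀ k, ∀ z ∈ T k, y * z - z * y ∈ T (k + 1)) (k n : ℕ) :
    ((adEnd K (C x * X + C y) ^ k) (C x : R[X])).coeff n ∈ T k := by
  induction k generalizing n with
  | zero =>
    rw [pow_zero, Module.End.one_apply, coeff_C]
    split_ifs
    exacts [hx0, zero_mem _]
  | succ k ih =>
    rw [pow_succ', Module.End.mul_apply]
    generalize (adEnd K (C x * X + C y) ^ k) (C x : R[X]) = g at ih
    have h : adEnd K (C x * X + C y) g =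
        (C x * g - g * C x) * X + (C y * g - g * C y) := by
      rw [adEnd_apply, add_mul, mul_add,
        sub_mul, mul_assoc, X_mul, mul_assoc, mul_assoc]
      abel
    rw [h, coeff_add]
    refine add_mem ?_ ?_
    · cases n with
      | zero => simp
      | succ n =>
        rw [coeff_mul_X, coeff_sub, coeff_C_mul, coeff_mul_C]
        exact hx k _ (ih n)
    · rw [coeff_sub, coeff_C_mul, coeff_mul_C]
      exact hy k _ (ih n)

/-- A form of Jacobson's formula: `(x + y) ^ p - x ^ p - y ^ p` is a combination of `p`-fold
iterated commutators of `x` and `y`. -/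
theorem add_pow_sub_mem (p : ℕ) [hp : Fact p.Prime] [CharP K p] (T : ℕ → Submodule K R) {x y : R}
    (hx0 : x ∈ T 0) (hx : ∀ k, ∀ z ∈ T k, x * z - z * x ∈ T (k + 1))
    (hy : ∀ k, ∀ z ∈ T k, y * z - z * y ∈ T (k + 1)) :
    (x + y) ^ p - x ^ p - y ^ p ∈ T (p - 1) := by
  set a : R[X] := C x * X + C y with ha
  have hder : derivative a = C x := by simp [ha]
  have hdeg : a.natDegree ≤ 1 := by
    refine natDegree_add_le_of_degree_le ?_ (by simp)
    exact natDegree_mul_le.trans (by simpa using natDegree_X_le)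
  have hdegp : (a ^ p).natDegree < p + 1 :=
    Nat.lt_succ_of_le (natDegree_pow_le.trans (by nlinarith))
  -- The derivative of `a ^ p` is an iterated commutator, and its coefficients recover those of `a ^
  -- p` in degrees strictly between `0` and `p`, where the degree is invertible in `K`. The extreme
  -- coefficients are `y ^ p` and `x ^ p`.
  have hmid : ∀ n, n + 1 < p → (a ^ p).coeff (n + 1) ∈ T (p - 1) := by
    intro n hn
    have h1 := coeff_ad_pow_mem T hx0 hx hy (p - 1) n
    rw [← ha, ← hder, ← derivative_pow_prime, coeff_derivative] at h1
    have hne : ((n + 1 : ℕ) : K) ≠ 0 := by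
      rw [Ne, CharP.cast_eq_zero_iff K p]
      exact fun hd => absurd (Nat.le_of_dvd n.succ_pos hd) (by omega)
    have h2 : (a ^ p).coeff (n + 1) * ((n : R) + 1) = ((n + 1 : ℕ) : K) • (a ^ p).coeff (n + 1) := by
      rw [Algebra.smul_def, map_natCast, ← Nat.cast_succ, (Nat.cast_commute _ _).eq]
    rw [h2] at h1
    have h3 := (T (p - 1)).smul_mem (((n + 1 : ℕ) : K)⁻¹) h1
    rwa [smul_smul, inv_mul_cancel₀ hne, one_smul] at h3
  -- Evaluation is multiplicative over noncommutative `R` here because `1` is central.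
  have hev : (a ^ p).eval 1 = (x + y) ^ p := by
    have := map_pow (eval₂RingHom' (RingHom.id R) 1 fun r => Commute.one_right r) a p
    simp only [eval₂RingHom'_apply] at this
    change eval 1 (a ^ p) = (eval 1 a) ^ p at this
    rw [this]
    simp [ha]
  have h0 : (a ^ p).coeff 0 = y ^ p := by
    have := map_pow (constantCoeff (R := R)) a p
    simpa [ha] using this
  have hpp : (a ^ p).coeff p = x ^ p := by
    have := coeff_pow_of_natDegree_le (m := p) hdeg
    simpa [ha] using this
  rw [← hev, eval_eq_sum_range' hdegp, Finset.sum_range_succ]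
  obtain ⟨q, hq⟩ : ∃ q, p = q + 1 := ⟨p - 1, (Nat.sub_add_cancel hp.out.one_le).symm⟩
  have hs : ∑ i ∈ Finset.range p, (a ^ p).coeff i * 1 ^ i =
      ∑ i ∈ Finset.range q, (a ^ p).coeff (i + 1) + y ^ p := by
    rw [← h0]
    conv_lhs => rw [hq]
    rw [Finset.sum_range_succ']
    simp [← hq]
  rw [hs, hpp, one_pow, mul_one, add_sub_cancel_right, add_sub_cancel_right]
  exact sum_mem fun i hi => hmid i (by have := Finset.mem_range.1 hi; omega)

end CharP

/-! ### The Lie algebra inside the endomorphisms of `K[G]`, and its finite dimension. -/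

section LieAlg

variable {K : Type u} [Field K] {A : Type v} [CommRing A] [HopfAlgebra K A]

variable (K A) in
/-- Left invariant derivations as linear endomorphisms of `K[G]`. -/
def toEnd : lieAlg K A →ₗ[K] Module.End K A where
  toFun x := (x.1 : A →ₗ[K] A)
  map_add' _ _ := rfl
  map_smul' _ _ := rfl

theorem toEnd_apply (x : lieAlg K A) (a : A) : toEnd K A x a = x.1 a := rfl

theorem toEnd_injective : Function.Injective (toEnd K A) := fun _ _ h =>
  Subtype.ext (Derivation.ext fun a => LinearMap.congr_fun h a)

theorem toEnd_lie (x y : lieAlg K A) :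
    toEnd K A ⁅x, y⁆ = toEnd K A x * toEnd K A y - toEnd K A y * toEnd K A x := by
  ext a
  exact Derivation.commutator_apply (D1 := x.1) (D2 := y.1) a

theorem toEnd_pMap (p : ℕ) [Fact p.Prime] [CharP K p] (x : lieAlg K A) :
    toEnd K A (pMap p x) = toEnd K A x ^ p := rfl

theorem toEnd_pMap_iterate (p : ℕ) [Fact p.Prime] [CharP K p] (x : lieAlg K A) (i : ℕ) :
    toEnd K A ((pMap p)^[i] x) = toEnd K A x ^ p ^ i := by
  induction i with
  | zero => simp
  | succ i ih => rw [Function.iterate_succ_apply', toEnd_pMap, ih, ← pow_mul, ← pow_succ]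

/-- Both entries are powers of one endomorphism of `K[G]`. This later supplies the commutation that
Frobenius needs in `U(𝔤)`. -/
theorem lie_pMap_iterate (p : ℕ) [Fact p.Prime] [CharP K p] (x : lieAlg K A) (i : ℕ) :
    ⁅x, (pMap p)^[i] x⁆ = 0 := by
  apply toEnd_injective
  rw [toEnd_lie, toEnd_pMap_iterate, map_zero, ← pow_succ, ← pow_succ', sub_self]

theorem pMap_smul (p : ℕ) [Fact p.Prime] [CharP K p] (c : K) (x : lieAlg K A) :
    pMap p (c • x) = c ^ p • pMap p x := by
  apply toEnd_injective
  rw [toEnd_pMap, map_smul, map_smul, toEnd_pMap, smul_pow]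

theorem pMap_zero (p : ℕ) [hp : Fact p.Prime] [CharP K p] : pMap p (0 : lieAlg K A) = 0 := by
  apply toEnd_injective
  rw [toEnd_pMap, map_zero, zero_pow hp.out.ne_zero]

theorem rightTranslation_inv_apply' (g : Points K A) (a : A) :
    rightTranslation g⁻¹ (rightTranslation g a) = a := by
  simpa using rightTranslation_inv_apply g⁻¹ a

theorem toEnd_Ad_pow_apply (g : Points K A) (x : lieAlg K A) (n : ℕ) (a : A) :
    (toEnd K A (Ad g x) ^ n) a =
      rightTranslation g ((toEnd K A x ^ n) (rightTranslation g⁻¹ a)) := by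
  induction n with
  | zero => simp [rightTranslation_inv_apply]
  | succ n ih =>
    rw [pow_succ', Module.End.mul_apply, ih, toEnd_apply, Ad_apply, rightTranslation_inv_apply',
      pow_succ', Module.End.mul_apply, toEnd_apply]

theorem Ad_pMap (p : ℕ) [Fact p.Prime] [CharP K p] (g : Points K A) (x : lieAlg K A) :
    Ad g (pMap p x) = pMap p (Ad g x) := by
  apply toEnd_injective
  ext a
  rw [toEnd_pMap, toEnd_Ad_pow_apply, toEnd_apply, Ad_apply]
  rfl

theorem Ad_lie (g : Points K A) (x y : lieAlg K A) : Ad g ⁅x, y⁆ = ⁅Ad g x, Ad g y⁆ := by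
  apply toEnd_injective
  ext a
  rw [toEnd_lie, toEnd_apply, Ad_apply, ← toEnd_apply, toEnd_lie]
  simp only [LinearMap.sub_apply, Module.End.mul_apply, toEnd_apply, Ad_apply,
    rightTranslation_inv_apply', map_sub]

/-- A left invariant derivation is determined by its values at the identity on algebra
generators. -/
theorem eq_zero_of_counit_eq_zero {s : Set A} (hs : Algebra.adjoin K s = ⊤) (x : lieAlg K A)
    (hx : ∀ a ∈ s, Coalgebra.counit (R := K) (x.1 a) = 0) : x = 0 := by
  have h1 : ∀ a, Coalgebra.counit (R := K) (x.1 a) = 0 := by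
    intro a
    have ha : a ∈ Algebra.adjoin K s := hs ▸ Algebra.mem_top
    induction ha using Algebra.adjoin_induction with
    | mem a ha => exact hx a ha
    | algebraMap r => simp
    | add a b _ _ ha hb => rw [map_add, map_add, ha, hb, add_zero]
    | mul a b _ _ ha hb =>
      rw [Derivation.leibniz, map_add, smul_eq_mul, smul_eq_mul, Bialgebra.counit_mul,
        Bialgebra.counit_mul, ha, hb, mul_zero, mul_zero, add_zero]
  apply toEnd_injective
  ext a
  -- Left invariance and the counit axiom recover `x` from `ε ∘ x`, the tangent vector at the
  -- identity, as `(id ⊗ ε ∘ x) ∘ Δ`.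
  have h2 := Coalgebra.lTensor_counit_comul (R := K) (x.1 a)
  have h3 : Coalgebra.counit (R := K) ∘ₗ (x.1 : A →ₗ[K] A) = 0 := LinearMap.ext h1
  rw [x.2 a, ← LinearMap.comp_apply, ← LinearMap.lTensor_comp, h3, LinearMap.lTensor_zero,
    LinearMap.zero_apply] at h2
  have h4 := congrArg (TensorProduct.rid K A) h2
  rw [map_zero, TensorProduct.rid_tmul, one_smul] at h4
  rw [toEnd_apply, ← h4, map_zero, LinearMap.zero_apply]

/-- A tangent vector at the identity is determined by its values on a finite generating set, which
embeds `𝔤` in a finite power of `K`. -/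
theorem finite_lieAlg [Algebra.FiniteType K A] : Module.Finite K (lieAlg K A) := by
  obtain ⟨s, hs⟩ := Algebra.FiniteType.out (R := K) (A := A)
  let Φ : lieAlg K A →ₗ[K] (s → K) :=
    LinearMap.pi fun a => Coalgebra.counit ∘ₗ LinearMap.applyₗ (a : A) ∘ₗ toEnd K A
  refine Module.Finite.of_injective Φ ((injective_iff_map_eq_zero Φ).2 fun x hx => ?_)
  exact eq_zero_of_counit_eq_zero hs x fun a ha => congrFun hx ⟨a, ha⟩

end LieAlg

/-! ### Weights of the cocharacter, the `p`-operation and the form. -/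

section Weights

variable {K : Type u} [Field K] {A : Type v} [CommRing A] [HopfAlgebra K A]
variable {lam : A →ₐc[K] K[T;T⁻¹]}

theorem exists_zpow_ne_one (K : Type*) [Field K] [Infinite K] {d : ℤ} (hd : d ≠ 0) :
    ∃ t : Kˣ, t ^ d ≠ 1 := by
  classical
  obtain ⟨a, ha⟩ := Infinite.exists_notMem_finset
    (insert 0 (Polynomial.nthRootsFinset d.natAbs (1 : K)))
  rw [Finset.mem_insert, not_or, Polynomial.mem_nthRootsFinset (Int.natAbs_pos.2 hd)] at ha
  refine ⟨Units.mk0 a ha.1, fun h => ha.2 ?_⟩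
  have h' := congrArg Units.val (pow_natAbs_eq_one.2 h)
  simpa using h'

theorem lie_mem_weightSpace {i j : ℤ} {x y : lieAlg K A} (hx : x ∈ weightSpace lam i)
    (hy : y ∈ weightSpace lam j) : ⁅x, y⁆ ∈ weightSpace lam (i + j) := fun t => by
  rw [Ad_lie, hx t, hy t, smul_lie, lie_smul, smul_smul, zpow_add, Units.val_mul]

theorem pMap_mem_weightSpace (p : ℕ) [Fact p.Prime] [CharP K p] {i : ℤ} {x : lieAlg K A}
    (hx : x ∈ weightSpace lam i) : pMap p x ∈ weightSpace lam (p * i) := fun t => by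
  rw [Ad_pMap, hx t, pMap_smul, mul_comm, zpow_mul, zpow_natCast, Units.val_pow_eq_pow_val]

/-- Invariance under `lam(t)` gives `t ^ (i + j) B(x, y) = B(x, y)` for every `t`. -/
theorem form_eq_zero_of_weight [Infinite K] {B : LinearMap.BilinForm K (lieAlg K A)}
    (hB : IsInvariantForm B) {i j : ℤ} (hij : i + j ≠ 0) {x y : lieAlg K A}
    (hx : x ∈ weightSpace lam i) (hy : y ∈ weightSpace lam j) : B x y = 0 := by
  obtain ⟨t, ht⟩ := exists_zpow_ne_one K hij
  have h := hB (cocharAt lam t) x y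
  rw [hx t, hy t, map_smul, map_smul, LinearMap.smul_apply, smul_smul, ← Units.val_mul, ← zpow_add,
    add_comm, smul_eq_mul] at h
  by_contra hne
  exact ht (Units.ext (mul_right_cancel₀ hne (h.trans (one_mul _).symm)))

/-- Over an infinite field the characters `t ↦ t ^ i` are distinct, hence independent by Dedekind.
So nonzero vectors of distinct weights are independent, and finite dimension bounds their number. -/
theorem finite_weights [Infinite K] [Module.Finite K (lieAlg K A)] (lam : A →ₐc[K] K[T;T⁻¹]) :
    {i : ℤ | weightSpace lam i ≠ ⊥}.Finite := by
  have hex : ∀ i : {i : ℤ | weightSpace lam i ≠ ⊥}, ∃ x ∈ weightSpace lam (i : ℤ), x ≠ 0 :=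
    fun i => (Submodule.ne_bot_iff _).1 i.2
  choose x hx hx0 using hex
  let c : ℤ → Kˣ →* K := fun i => (Units.coeHom K).comp (zpowGroupHom i)
  have hc : Function.Injective c := by
    intro i j hij
    by_contra hne
    obtain ⟨t, ht⟩ := exists_zpow_ne_one K (sub_ne_zero.2 hne)
    apply ht
    have h : t ^ i = t ^ j := Units.ext (DFunLike.congr_fun hij t)
    rw [zpow_sub, h, mul_inv_cancel]
  have hind := (linearIndependent_monoidHom Kˣ K).comp
    (fun i : {i : ℤ | weightSpace lam i ≠ ⊥} => c i) (hc.comp Subtype.val_injective)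
  have hli : LinearIndependent K x := by
    rw [linearIndependent_iff']
    intro s g hg i hi
    by_contra hgi
    apply hx0 i
    -- Acting by `lam(t)` and applying a functional `f` turns a relation among the `x i` into one
    -- among the characters, with coefficients `g i * f (x i)`.
    rw [← Module.forall_dual_apply_eq_zero_iff K]
    intro f
    have h := linearIndependent_iff'.1 hind s (fun i => g i * f (x i)) ?_ i hi
    · exact (mul_eq_zero.1 h).resolve_left hgi
    · ext t
      have ht := congrArg (fun y => f (Ad (cocharAt lam t) y)) hg
      simp only [map_sum, map_smul, map_zero] at ht
      rw [Finset.sum_apply, Pi.zero_apply, ← ht]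
      refine Finset.sum_congr rfl fun j _ => ?_
      rw [hx j t, map_smul]
      simp only [Pi.smul_apply, Function.comp_apply, smul_eq_mul]
      change g j * f (x j) * ((t ^ (j : ℤ) : Kˣ) : K) = _
      ring
  have := hli.finite_of_isNoetherian
  exact Set.toFinite _

/-- The sum of the weight spaces of weight at most `w`. -/
def weightLE (lam : A →ₐc[K] K[T;T⁻¹]) (w : ℤ) : Submodule K (lieAlg K A) :=
  ⨆ i : Set.Iic w, weightSpace lam (i : ℤ)

theorem weightSpace_le_weightLE {i w : ℤ} (h : i ≤ w) : weightSpace lam i ≤ weightLE lam w :=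
  le_iSup (fun i : Set.Iic w => weightSpace lam (i : ℤ)) ⟨i, h⟩

theorem weightLE_mono {v w : ℤ} (h : v ≤ w) : weightLE lam v ≤ weightLE lam w :=
  iSup_le fun i => weightSpace_le_weightLE (i.2.trans h)

theorem lie_mem_weightLE {v w : ℤ} {x y : lieAlg K A} (hx : x ∈ weightLE lam v)
    (hy : y ∈ weightLE lam w) : ⁅x, y⁆ ∈ weightLE lam (v + w) := by
  induction hx using Submodule.iSup_induction' with
  | zero => simp
  | add x x' _ _ hx hx' => rw [add_lie]; exact add_mem hx hx'
  | mem i x hx =>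
    induction hy using Submodule.iSup_induction' with
    | zero => simp
    | add y y' _ _ hy hy' => rw [lie_add]; exact add_mem hy hy'
    | mem j y hy =>
      exact weightSpace_le_weightLE (add_le_add i.2 j.2) (lie_mem_weightSpace hx hy)

/-- Jacobson's formula with `T k` the image of weights at most `(k + 1) * w`: `k` brackets involve
`k + 1` factors, so `T (p - 1)` has bound `p * w`. -/
theorem pMap_add_sub_mem_weightLE (p : ℕ) [hp : Fact p.Prime] [CharP K p] {w : ℤ}
    {x y : lieAlg K A} (hx : x ∈ weightLE lam w) (hy : y ∈ weightLE lam w) :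
    pMap p (x + y) - pMap p x - pMap p y ∈ weightLE lam (p * w) := by
  have key : ∀ z ∈ weightLE lam w, ∀ k : ℕ,
      ∀ u ∈ (weightLE lam ((k + 1 : ℕ) * w)).map (toEnd K A),
      toEnd K A z * u - u * toEnd K A z ∈ (weightLE lam ((k + 1 + 1 : ℕ) * w)).map (toEnd K A) := by
    rintro z hz k _ ⟨u, hu, rfl⟩
    refine ⟨⁅z, u⁆, ?_, toEnd_lie z u⟩
    have h : ((k + 1 + 1 : ℕ) : ℤ) * w = w + (k + 1 : ℕ) * w := by push_cast; ring
    rw [h]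
    exact lie_mem_weightLE hz hu
  obtain ⟨z, hz, h⟩ := add_pow_sub_mem p
    (fun k : ℕ => (weightLE lam ((k + 1 : ℕ) * w)).map (toEnd K A))
    (x := toEnd K A x) (y := toEnd K A y) ⟨x, by simpa using hx, rfl⟩ (key x hx) (key y hy)
  rw [Nat.sub_add_cancel hp.out.one_le] at hz
  have h' : pMap p (x + y) - pMap p x - pMap p y = z := by
    apply toEnd_injective
    rw [h, map_sub, map_sub, toEnd_pMap, toEnd_pMap, toEnd_pMap, map_add]
  exact h' ▸ hz

theorem pMap_mem_weightLE (p : ℕ) [Fact p.Prime] [CharP K p] {w : ℤ} {x : lieAlg K A}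
    (hx : x ∈ weightLE lam w) : pMap p x ∈ weightLE lam (p * w) := by
  induction hx using Submodule.iSup_induction' with
  | zero => rw [pMap_zero]; exact zero_mem _
  | mem i x hx =>
    exact weightSpace_le_weightLE (mul_le_mul_of_nonneg_left i.2 (Int.natCast_nonneg p))
      (pMap_mem_weightSpace p hx)
  | add x y hx hy hpx hpy =>
    have h := add_mem (add_mem (pMap_add_sub_mem_weightLE p hx hy) hpx) hpy
    rwa [sub_right_comm, sub_add_cancel, sub_add_cancel] at h

theorem pMap_iterate_mem_weightLE (p : ℕ) [Fact p.Prime] [CharP K p] {w : ℤ} {x : lieAlg K A}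
    (hx : x ∈ weightLE lam w) (n : ℕ) : (pMap p)^[n] x ∈ weightLE lam (p ^ n * w) := by
  induction n with
  | zero => simpa using hx
  | succ n ih =>
    rw [Function.iterate_succ_apply', pow_succ', mul_assoc]
    exact pMap_mem_weightLE p ih

theorem exists_weightLE_eq_bot [Infinite K] [Module.Finite K (lieAlg K A)]
    (lam : A →ₐc[K] K[T;T⁻¹]) : ∃ w : ℤ, weightLE lam w = ⊥ := by
  obtain ⟨b, hb⟩ := (finite_weights lam).bddBelow
  refine ⟨b - 1, iSup_eq_bot.2 fun i => ?_⟩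
  by_contra h
  have h1 := hb h
  have h2 : (i : ℤ) ≤ b - 1 := i.2
  omega

theorem exists_pMap_iterate_eq_zero [Infinite K] [Module.Finite K (lieAlg K A)] (p : ℕ)
    [hp : Fact p.Prime] [CharP K p] {x : lieAlg K A} (hx : x ∈ weightLE lam (-1)) :
    ∃ i : ℕ, 0 < i ∧ (pMap p)^[i] x = 0 := by
  obtain ⟨w, hw⟩ := exists_weightLE_eq_bot lam
  -- Since `p ^ n > n`, this exponent pushes `-p ^ n` below `w`; the `+ 1` also keeps it positive.
  refine ⟨w.natAbs + 1, Nat.succ_pos _, ?_⟩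
  have h := pMap_iterate_mem_weightLE p hx (w.natAbs + 1)
  have h1 : w.natAbs + 1 < p ^ (w.natAbs + 1) := Nat.lt_pow_self hp.out.one_lt
  have h2 : ((p : ℤ) ^ (w.natAbs + 1)) * -1 ≤ w := by
    have : ((w.natAbs + 1 : ℕ) : ℤ) < (p : ℤ) ^ (w.natAbs + 1) := by exact_mod_cast h1
    omega
  have h3 := weightLE_mono h2 h
  rwa [hw, Submodule.mem_bot] at h3

theorem form_eq_zero_of_mem_weightLE [Infinite K] {B : LinearMap.BilinForm K (lieAlg K A)}
    (hB : IsInvariantForm B) {e x : lieAlg K A} (he : e ∈ weightSpace lam 2)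
    (hx : x ∈ weightLE lam (-3)) : B e x = 0 := by
  induction hx using Submodule.iSup_induction' with
  | zero => simp
  | add x y _ _ hx hy => rw [map_add, hx, hy, add_zero]
  | mem i x hx =>
    have hi : (i : ℤ) ≤ -3 := i.2
    exact form_eq_zero_of_weight hB (by omega) he hx

theorem premetM_eq (lam : A →ₐc[K] K[T;T⁻¹]) (l : Submodule K (lieAlg K A)) :
    premetM lam l = l ⊔ weightLE lam (-2) := by
  have h : ⨆ i < (-1 : ℤ), weightSpace lam i = weightLE lam (-2) := by
    apply le_antisymm
    · exact iSup₂_le fun i hi => weightSpace_le_weightLE (by omega)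
    · exact iSup_le fun i => le_iSup₂_of_le (i : ℤ) (lt_of_le_of_lt i.2 (by norm_num)) le_rfl
  rw [premetM, h]

variable {p : ℕ} [hp : Fact p.Prime] [CharP K p] {B : LinearMap.BilinForm K (lieAlg K A)}
  {e : lieAlg K A} {l : Submodule K (lieAlg K A)}

theorem premetM_le_weightLE (hl : IsLagrangian p B e lam l) :
    premetM lam l ≤ weightLE lam (-1) := by
  rw [premetM_eq]
  exact sup_le (hl.maximal.prop.1.trans (weightSpace_le_weightLE le_rfl))
    (weightLE_mono (by norm_num))

/-- As `p ≥ 2`, the `p`-th power has weights at most `-2`, and all of these belong to `𝔪`. -/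
theorem pMap_mem_premetM (hl : IsLagrangian p B e lam l) {x : lieAlg K A}
    (hx : x ∈ premetM lam l) : pMap p x ∈ premetM lam l := by
  have h := pMap_mem_weightLE p (premetM_le_weightLE hl hx)
  have h2 : (2 : ℤ) ≤ p := by exact_mod_cast hp.out.two_le
  rw [premetM_eq]
  exact le_sup_right (a := l) (weightLE_mono (by omega) h)

/-- The character `χ = (e, ·)` vanishes on the `p`-th powers of elements of `𝔪`. -/
theorem form_pMap_eq_zero [Infinite K] (hB : IsInvariantForm B) (he : e ∈ weightSpace lam 2)
    (hl : IsLagrangian p B e lam l) {x : lieAlg K A} (hx : x ∈ premetM lam l) :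
    B e (pMap p x) = 0 := by
  rcases hp.out.eq_two_or_odd' with h2 | hodd
  · subst h2
    rw [premetM_eq] at hx
    obtain ⟨u, hu, v, hv, rfl⟩ := Submodule.mem_sup.1 hx
    have hu1 : u ∈ weightLE lam (-1) := weightSpace_le_weightLE le_rfl (hl.maximal.prop.1 hu)
    -- In characteristic `2` the cross terms `uv + vu` form the commutator. Here `v` has weights at
    -- most `-2`, so only `pMap 2 u` can reach weight `-2`.
    have hsum : pMap 2 (u + v) = pMap 2 u + (pMap 2 v + ⁅u, v⁆) := by
      apply toEnd_injective
      rw [toEnd_pMap, map_add, map_add, map_add, toEnd_pMap, toEnd_pMap, toEnd_lie]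
      have h0 : (2 : Module.End K A) = 0 := by
        exact_mod_cast natCast_eq_zero_of_algebra (K := K) (R := Module.End K A) 2
      have h1 : toEnd K A v * toEnd K A u = -(toEnd K A v * toEnd K A u) :=
        eq_neg_of_add_eq_zero_left (by rw [← two_mul, h0, zero_mul])
      rw [sub_eq_add_neg, ← h1]
      noncomm_ring
    have hv2 : pMap 2 v ∈ weightLE lam (-3) :=
      weightLE_mono (by norm_num) (pMap_mem_weightLE 2 hv)
    have huv : ⁅u, v⁆ ∈ weightLE lam (-3) :=
      weightLE_mono (by norm_num) (lie_mem_weightLE hu1 hv)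
    rw [hsum, map_add, hl.two rfl u hu, zero_add]
    exact form_eq_zero_of_mem_weightLE hB he (add_mem hv2 huv)
  · have h3 : (3 : ℤ) ≤ p := by
      have := hp.out.two_le
      obtain ⟨k, hk⟩ := hodd
      omega
    exact form_eq_zero_of_mem_weightLE hB he
      (weightLE_mono (by omega) (pMap_mem_weightLE p (premetM_le_weightLE hl hx)))

end Weights

/-! ### Congruences modulo `I(𝔪) U(𝔤)` and their action on modules. -/

section Enveloping

attribute [local instance] LieRing.ofAssociativeRing

variable {K : Type u} [Field K] {A : Type v} [CommRing A] [HopfAlgebra K A]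
theorem incl_zero : incl (0 : lieAlg K A) = 0 := map_zero _

/-- The zero character of `𝔤` lifts to an algebra map `U(𝔤) → K`. Nontriviality lets `U(𝔤)` inherit
characteristic `p`. -/
instance nontrivial_Ug : Nontrivial (Ug K A) :=
  (UniversalEnvelopingAlgebra.lift K (0 : lieAlg K A →ₗ⁅K⁆ K)).toRingHom.domain_nontrivial

theorem charP_Ug (p : ℕ) [CharP K p] : CharP (Ug K A) p :=
  charP_of_injective_algebraMap (algebraMap K (Ug K A)).injective p

variable {p : ℕ} [hp : Fact p.Prime] [CharP K p]

/-- Absorbing a factor on the right needs only associativity, and suffices for taking powers;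
centrality of `Z₀(𝔤)` does not enter. -/
theorem mul_mem_extIdeal {I : Ideal (pCentre K A p)} {w : Ug K A} (hw : w ∈ extIdeal p I)
    (y : Ug K A) : w * y ∈ extIdeal p I := by
  induction hw using Submodule.span_induction with
  | mem w hw =>
    obtain ⟨z, hz, u, rfl⟩ := hw
    exact Submodule.subset_span ⟨z, hz, u * y, mul_assoc _ _ _⟩
  | zero => rw [zero_mul]; exact zero_mem _
  | add a b _ _ ha hb => rw [add_mul]; exact add_mem ha hb
  | smul c a _ ha => rw [smul_mul_assoc]; exact Submodule.smul_mem _ c ha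

theorem pow_mem_extIdeal {I : Ideal (pCentre K A p)} {w : Ug K A} (hw : w ∈ extIdeal p I)
    {n : ℕ} (hn : n ≠ 0) : w ^ n ∈ extIdeal p I := by
  obtain ⟨k, rfl⟩ := Nat.exists_eq_succ_of_ne_zero hn
  rw [pow_succ']
  exact mul_mem_extIdeal hw _

variable {χ : Module.Dual K (lieAlg K A)} {m : Submodule K (lieAlg K A)}

/-- Every `ψ ∈ 𝔪^⊥` vanishes at `x`, so this element is one of the defining generators of each
`I_{χ+ψ}`. -/
theorem xi_sub_mem_extIdeal {x : lieAlg K A} (hx : x ∈ m) :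
    xi p x - algebraMap K (Ug K A) (χ x ^ p) ∈ extIdeal p (idealM p χ m) := by
  refine Submodule.subset_span ⟨⟨xi p x, Algebra.subset_adjoin ⟨x, rfl⟩⟩ -
    algebraMap K (pCentre K A p) (χ x ^ p), ?_, 1, (mul_one _).symm⟩
  simp only [idealM, Submodule.mem_iInf]
  intro ψ hψ
  have h : (χ + ψ) x = χ x := by
    rw [LinearMap.add_apply, (Submodule.mem_dualAnnihilator ψ).1 hψ x hx, add_zero]
  rw [← h]
  exact Ideal.subset_span ⟨x, rfl⟩

theorem shift_pow_sub_mem {x : lieAlg K A} (hx : x ∈ m) :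
    shift χ x ^ p - incl (pMap p x) ∈ extIdeal p (idealM p χ m) := by
  have : CharP (Ug K A) p := charP_Ug (K := K) p
  have h : shift χ x ^ p - incl (pMap p x) = xi p x - algebraMap K (Ug K A) (χ x ^ p) := by
    rw [shift, sub_pow_char_of_commute _ (Algebra.commute_algebraMap_right _ _), xi, map_pow]
    abel
  rw [h]
  exact xi_sub_mem_extIdeal hx

/-- If `𝔪` is stable under the `p`-operation and `χ` vanishes on `p`-th powers from `𝔪`, then
`(x - χ(x)) ^ (p ^ i)` and `x^{[p]^i}` agree modulo `I(𝔪) U(𝔤)` for all `x ∈ 𝔪`. -/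
theorem shift_pow_pow_sub_mem (hm : ∀ x ∈ m, pMap p x ∈ m) (hχ : ∀ x ∈ m, χ (pMap p x) = 0)
    {x : lieAlg K A} (hx : x ∈ m) {i : ℕ} (hi : 0 < i) :
    shift χ x ^ p ^ i - incl ((pMap p)^[i] x) ∈ extIdeal p (idealM p χ m) := by
  have : CharP (Ug K A) p := charP_Ug (K := K) p
  have hmi : ∀ n, (pMap p)^[n] x ∈ m := by
    intro n
    induction n with
    | zero => exact hx
    | succ n ih => rw [Function.iterate_succ_apply']; exact hm _ ih
  induction i, hi using Nat.le_induction with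
  | base => simpa using shift_pow_sub_mem hx
  | succ i hi ih =>
    set y := (pMap p)^[i] x with hy
    -- Because `i ≥ 1`, `y` is itself a `p`-th power of an element of `𝔪`.
    have hχy : χ y = 0 := by
      obtain ⟨j, rfl⟩ := Nat.exists_eq_succ_of_ne_zero (Nat.one_le_iff_ne_zero.1 hi)
      rw [hy, Function.iterate_succ_apply']
      exact hχ _ (hmi j)
    have hcomm : Commute (shift χ x) (incl y) := by
      refine Commute.sub_left ?_ (Algebra.commute_algebraMap_left _ _)
      have h : ⁅incl x, incl y⁆ = 0 := by rw [← LieHom.map_lie, lie_pMap_iterate, map_zero]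
      rwa [LieRing.of_associative_ring_bracket, sub_eq_zero] at h
    -- The `p`-th power of the inductive difference is the difference of `p`-th powers, as its terms
    -- commute. It is then chained with the first congruence for `y`, where the shift is zero.
    have h1 := pow_mem_extIdeal ih hp.out.ne_zero
    rw [sub_pow_char_of_commute _ (hcomm.pow_left _), ← pow_mul, ← pow_succ] at h1
    have h2 := shift_pow_sub_mem (p := p) (χ := χ) (hmi i)
    rw [← hy, shift, hχy, map_zero, sub_zero] at h2
    have h3 := add_mem h1 h2
    rwa [sub_add_sub_cancel, ← Function.iterate_succ_apply' (pMap p)] at h3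

theorem extIdeal_smul_eq_zero {V : ModuleCat.{w} (Ug K A)} (hV : pWhittaker p χ m V) {y : Ug K A}
    (hy : y ∈ extIdeal p (idealM p χ m)) (v : V) : y • v = 0 := by
  induction hy using Submodule.span_induction with
  | mem y hy =>
    obtain ⟨z, hz, u, rfl⟩ := hy
    rw [mul_smul]
    exact hV z hz _
  | zero => exact zero_smul _ v
  | add a b _ _ ha hb => rw [add_smul, ha, hb, add_zero]
  | smul c a _ ha => rw [Algebra.smul_def, mul_smul, ha, smul_zero]

end Enveloping

end ModularW

/-! ### The main theorem. -/

theorem mainTheorem7 {K : Type u} [Field K] [IsAlgClosed K] (p : ℕ) [Fact p.Prime] [CharP K p]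
    {A : Type v} [CommRing A] [HopfAlgebra K A] [Algebra.FiniteType K A]
    (B : LinearMap.BilinForm K (ModularW.lieAlg K A)) (hB : B.Nondegenerate)
    (hBinv : ModularW.IsInvariantForm B)
    (e : ModularW.lieAlg K A) (he : ModularW.IsPNilpotent p e)
    (lam : A →ₐc[K] LaurentPolynomial K) (hlam : ModularW.IsDynkinTorus lam e)
    (l : Submodule K (ModularW.lieAlg K A)) (hl : ModularW.IsLagrangian p B e lam l)
    (χ : Module.Dual K (ModularW.lieAlg K A)) (hχ : χ = B e)
    (m : Submodule K (ModularW.lieAlg K A)) (hm : m = ModularW.premetM lam l) :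
    (∃ h : ModularW.pWhittaker.{u, v, w} p χ m ≤ ModularW.genWhittaker.{u, v, w} χ m,
      (CategoryTheory.ObjectProperty.ιOfLE h).Full ∧
      (CategoryTheory.ObjectProperty.ιOfLE h).Faithful) ∧
    (∀ x ∈ m, ∀ i : ℕ, 0 < i →
      ModularW.shift χ x ^ p ^ i - ModularW.incl ((ModularW.pMap p)^[i] x) ∈
        ModularW.extIdeal p (ModularW.idealM p χ m)) ∧
    (∀ x ∈ m, ∃ i : ℕ, 0 < i ∧ (ModularW.pMap p)^[i] x = 0 ∧
      ModularW.shift χ x ^ p ^ i ∈ ModularW.extIdeal p (ModularW.idealM p χ m)) ∧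
    (∀ x ∈ m, ∃ N : ℕ, ∀ V : ModuleCat.{w} (ModularW.Ug K A),
      ModularW.pWhittaker p χ m V → ∀ v : V, ModularW.shift χ x ^ N • v = 0) := by
  have : Infinite K := IsAlgClosed.instInfinite
  have : Module.Finite K (ModularW.lieAlg K A) := ModularW.finite_lieAlg
  subst hm hχ
  have h1 : ∀ x ∈ ModularW.premetM lam l, ∀ i : ℕ, 0 < i →
      ModularW.shift (B e) x ^ p ^ i - ModularW.incl ((ModularW.pMap p)^[i] x) ∈
        ModularW.extIdeal p (ModularW.idealM p (B e) (ModularW.premetM lam l)) :=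
    fun x hx i hi => ModularW.shift_pow_pow_sub_mem (fun _ h => ModularW.pMap_mem_premetM hl h)
      (fun _ h => ModularW.form_pMap_eq_zero hBinv hlam.mem_two hl h) hx hi
  have h2 : ∀ x ∈ ModularW.premetM lam l, ∃ i : ℕ, 0 < i ∧ (ModularW.pMap p)^[i] x = 0 ∧
      ModularW.shift (B e) x ^ p ^ i ∈
        ModularW.extIdeal p (ModularW.idealM p (B e) (ModularW.premetM lam l)) := by
    intro x hx
    obtain ⟨i, hi, hxi⟩ :=
      ModularW.exists_pMap_iterate_eq_zero p (ModularW.premetM_le_weightLE hl hx)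
    have h := h1 x hx i hi
    rw [hxi, ModularW.incl_zero, sub_zero] at h
    exact ⟨i, hi, hxi, h⟩
  have h3 : ∀ x ∈ ModularW.premetM lam l, ∃ N : ℕ, ∀ V : ModuleCat.{w} (ModularW.Ug K A),
      ModularW.pWhittaker p (B e) (ModularW.premetM lam l) V →
        ∀ v : V, ModularW.shift (B e) x ^ N • v = 0 := by
    intro x hx
    obtain ⟨i, -, -, h⟩ := h2 x hx
    -- The exponent comes from the vanishing of `x^{[p]^i}` in `𝔤`, before any module is chosen;
    -- hence the uniformity.
    exact ⟨p ^ i, fun V hV v => ModularW.extIdeal_smul_eq_zero hV h v⟩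
  refine ⟨⟨fun V hV x hx v => ?_, CategoryTheory.ObjectProperty.full_ιOfLE _,
    CategoryTheory.ObjectProperty.faithful_ιOfLE _⟩, h1, h2, h3⟩
  obtain ⟨N, hN⟩ := h3 x hx
  exact ⟨N, hN V hV v⟩
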